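/- Let $U\subseteq\mathbf R^2$ be open and let $F:U\to\mathbf R^2$ be a $C^\infty$ map with $\partial F/\partial t\neq 0$ everywhere on $U$. For $s\in\mathbf R$ let $\Gamma_s$ be the (immersed, possibly empty) plane curve $t\mapsto F(s,t)$, where $t$ runs over all real numbers with $(s,t)\in U$. Let $d\ge 0$ be an integer, and suppose that all curves $\Gamma_s$ are algebraic of degree $d$ and nonsingular, with equations depending smoothly on $s$: for every $s_0$ with $\Gamma_{s_0}\neq\emptyset$ there are real polynomials $f_s(x,y)$ of total degree $d$, defined for $s$ in a neighbourhood of $s_0$ and with coefficients that are $C^\infty$ functions of $s$, such that $f_s=0$ and $df_s\neq 0$ at every point of $\Gamma_s$. The infinitesimal intersection multiplicity of $\Gamma_s$ at a point $p=F(s,t)$ is the order of vanishing at $t$ of the function $t\mapsto \det DF(s,t)$ (the order is $\infty$ if all derivatives vanish; if $\Gamma_s$ passes through $p$ for several values of $t$, take the supremum of the orders). The infinitesimal intersection index of $\Gamma_s$ is the sum of these multiplicities over all points $p$ of $\Gamma_s$. Then, for every $s$ such that the function $t\mapsto\det DF(s,t)$ does not vanish identically on any non-empty open interval contained in $\{t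 : (s,t)\in U\}$, the infinitesimal intersection index of $\Gamma_s$ is at most $d^2$. -/

import Mathlib

open scoped ContDiff

/-- The curve `Γ_s` of the family `F` with domain `U`: the points `F (s, t)` with `(s, t) ∈ U`. -/
def familyCurve (U : Set (ℝ × ℝ)) (F : ℝ × ℝ → ℝ × ℝ) (s : ℝ) : Set (ℝ × ℝ) :=
  {p | ∃ t : ℝ, (s, t) ∈ U ∧ F (s, t) = p}

/-- The Jacobian of `F` at `(s, t)`. -/
noncomputable def jacobian (F : ℝ × ℝ → ℝ × ℝ) (s t : ℝ) : ℝ :=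
  (fderiv ℝ F (s, t)).det

/-- The order of vanishing at `t` of a real function that is smooth near `t`: the least `n` with
`h⁽ⁿ⁾(t) ≠ 0`, and `⊤` if all derivatives vanish at `t`. -/
noncomputable def vanishingOrder (h : ℝ → ℝ) (t : ℝ) : ℕ∞ :=
  ⨅ (n : ℕ) (_ : iteratedDeriv n h t ≠ 0), (n : ℕ∞)

/-- The infinitesimal intersection multiplicity of `Γ_s` at the point `p`: the order of vanishing
of `t ↦ jacobian F s t` at a parameter value `t` with `F (s, t) = p`. If `Γ_s` passes through `p`
for several parameter values, the largest of the orders is taken (for the families below they all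
agree). -/
noncomputable def infIntersectionMultiplicity (U : Set (ℝ × ℝ)) (F : ℝ × ℝ → ℝ × ℝ) (s : ℝ)
    (p : ℝ × ℝ) : ℕ∞ :=
  ⨆ (t : ℝ) (_ : (s, t) ∈ U ∧ F (s, t) = p), vanishingOrder (jacobian F s) t

/-- The infinitesimal intersection index of `Γ_s`: the sum of the multiplicities over all points of
the curve (an unordered sum in `ℕ∞`, the supremum of its finite partial sums). -/
noncomputable def infIntersectionIndex (U : Set (ℝ × ℝ)) (F : ℝ × ℝ → ℝ × ℝ) (s : ℝ) : ℕ∞ :=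
  ⨆ T : Finset (familyCurve U F s), ∑ p ∈ T, infIntersectionMultiplicity U F s p

/-- The value of a real polynomial in two variables at a point of the plane. -/
noncomputable def evalAt (p : ℝ × ℝ) (f : MvPolynomial (Fin 2) ℝ) : ℝ :=
  MvPolynomial.eval ![p.1, p.2] f

/-- The curves `Γ_s` are algebraic of degree `d`, given by polynomial equations `f_s = 0` that
depend smoothly on `s` (near each value `s₀` for which `Γ_{s₀}` is non-empty), and `df_s` vanishes
nowhere on `Γ_s`. -/
def IsAlgebraicFamily (U : Set (ℝ × ℝ)) (F : ℝ × ℝ → ℝ × ℝ) (d : ℕ) : Prop :=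
  ∀ s₀ : ℝ, (familyCurve U F s₀).Nonempty →
    ∃ f : ℝ → MvPolynomial (Fin 2) ℝ, ∃ V : Set ℝ, IsOpen V ∧ s₀ ∈ V ∧
      (∀ m : Fin 2 →₀ ℕ, ContDiffOn ℝ ∞ (fun s => (f s).coeff m) V) ∧
      ∀ s ∈ V, (f s).totalDegree = d ∧
        ∀ p ∈ familyCurve U F s, evalAt p (f s) = 0 ∧
          ¬ (evalAt p (MvPolynomial.pderiv 0 (f s)) = 0 ∧
            evalAt p (MvPolynomial.pderiv 1 (f s)) = 0)

open Filter Topology Asymptotics MvPolynomial Module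

/-! ### Dimension of the space of plane polynomials of bounded degree -/

/-! Put `g = ∂f_s/∂s`, a polynomial of degree at most `d`. Differentiating `f_s(F(s,t)) = 0` in `s`
and in `t` and applying Cramer's rule (`jacobian_relations`) gives `J · ∇f_s = g · (-y', x')` along
the curve. As `(x', y') ≠ 0`, `g` vanishes along the curve at least to the order of `J`, so Bézout
for `f_s` and `g` should bound the index by `d²`.

Bézout needs coprime polynomials, so write `f_s = h k`, `g = h q` with `k`, `q` coprime. The factor
`h` has no zero on the curve: at such a zero `k ≠ 0` because `df_s ≠ 0`, so `h`, hence `g`, vanishes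
along a whole arc, and then so does `J`, which is excluded. Thus `k` vanishes on the curve and `q`
still vanishes to the order of `J`.

The Bézout inequality `sum_contact_le_of_isRelPrime` is a dimension count in large degree: multiples
of `k` and `q` span a space of codimension at most `deg k * deg q`, while contact conditions of
total order `m` at distinct points cut out codimension at least `m`. -/

theorem two_mul_natCard_degree_le_fin_two (N : ℕ) :
    2 * Nat.card {m : Fin 2 →₀ ℕ | m.degree ≤ N} = (N + 1) * (N + 2) := by
  have e : {m : Fin 2 →₀ ℕ | m.degree ≤ N} ≃ Σ i : Fin (N + 1), Fin (N + 1 - i) :=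
    { toFun := fun m => ⟨⟨m.1 0, by
          have := m.2
          simp only [Set.mem_ofPred_eq, Finsupp.degree_eq_sum, Fin.sum_univ_two] at this
          omega⟩, ⟨m.1 1, by
          have := m.2
          simp only [Set.mem_ofPred_eq, Finsupp.degree_eq_sum, Fin.sum_univ_two] at this
          simp only
          omega⟩⟩
      invFun := fun x => ⟨Finsupp.equivFunOnFinite.symm ![x.1, x.2], by
          have := x.2.2
          simp only [Set.mem_ofPred_eq, Finsupp.degree_eq_sum, Fin.sum_univ_two]
          simp
          omega⟩
      left_inv := fun m => by
        ext i
        fin_cases i <;> simp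
      right_inv := fun x => by
        simp }
  rw [Nat.card_congr e, Nat.card_eq_fintype_card, Fintype.card_sigma]
  simp only [Fintype.card_fin]
  rw [Fin.sum_univ_eq_sum_range (fun i => N + 1 - i) (N + 1),
    ← Finset.sum_range_reflect]
  have : ∀ i ∈ Finset.range (N + 1), N + 1 - (N + 1 - 1 - i) = i + 1 := by
    intro i hi
    rw [Finset.mem_range] at hi
    omega
  rw [Finset.sum_congr rfl this, Finset.sum_add_distrib, mul_add, mul_comm 2 (∑ i ∈ _, i),
    Finset.sum_range_id_mul_two]
  simp
  ring

theorem finrank_restrictTotalDegree_fin_two (K : Type*) [Field K] (N : ℕ) :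
    2 * finrank K (restrictTotalDegree (Fin 2) K N) = (N + 1) * (N + 2) := by
  rw [← two_mul_natCard_degree_le_fin_two, ← finrank_eq_nat_card_basis
    (basisRestrictSupport K {m : Fin 2 →₀ ℕ | m.degree ≤ N})]
  congr 2

theorem finrank_map_mulLeft {p : MvPolynomial (Fin 2) ℝ} (hp : p ≠ 0)
    (S : Submodule ℝ (MvPolynomial (Fin 2) ℝ)) :
    finrank ℝ (S.map (LinearMap.mulLeft ℝ p)) = finrank ℝ S :=
  (LinearEquiv.finrank_eq (Submodule.equivMapOfInjective _
    (fun _ _ h => mul_left_cancel₀ hp h) S)).symm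

theorem map_mulLeft_restrictTotalDegree_le (p : MvPolynomial (Fin 2) ℝ) (N : ℕ) :
    (restrictTotalDegree (Fin 2) ℝ N).map (LinearMap.mulLeft ℝ p) ≤
      restrictTotalDegree (Fin 2) ℝ (p.totalDegree + N) := by
  rintro _ ⟨u, hu, rfl⟩
  rw [SetLike.mem_coe, mem_restrictTotalDegree] at hu
  rw [mem_restrictTotalDegree, LinearMap.mulLeft_apply]
  exact (totalDegree_mul _ _).trans (by omega)

/-- For coprime plane polynomials `k`, `q`, a space of polynomials of degree at most
`deg k + deg q + M` containing all multiples of `k` and `q` has codimension at most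
`deg k * deg q`. -/
theorem finrank_restrictTotalDegree_le_of_isRelPrime {k q : MvPolynomial (Fin 2) ℝ} (hk : k ≠ 0)
    (hq : q ≠ 0) (hkq : IsRelPrime k q) (M : ℕ) (I : Submodule ℝ (MvPolynomial (Fin 2) ℝ))
    (hkI : ∀ u, k * u ∈ I) (hqI : ∀ u, q * u ∈ I) :
    finrank ℝ (restrictTotalDegree (Fin 2) ℝ (k.totalDegree + q.totalDegree + M)) ≤
      finrank ℝ ↥(restrictTotalDegree (Fin 2) ℝ (k.totalDegree + q.totalDegree + M) ⊓ I) +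
        k.totalDegree * q.totalDegree := by
  set a := k.totalDegree with ha
  set b := q.totalDegree with hb
  set A := (restrictTotalDegree (Fin 2) ℝ (b + M)).map (LinearMap.mulLeft ℝ k) with hA
  set B := (restrictTotalDegree (Fin 2) ℝ (a + M)).map (LinearMap.mulLeft ℝ q) with hB
  -- By coprimality a common multiple of `k` and `q` is a multiple of `k * q`; degrees add, so the
  -- cofactor has degree at most `M`.
  have hAB : A ⊓ B ≤ (restrictTotalDegree (Fin 2) ℝ M).map (LinearMap.mulLeft ℝ (k * q)) := by
    rintro x ⟨⟨u, hu, rfl⟩, ⟨v, -, hv⟩⟩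
    rw [SetLike.mem_coe, mem_restrictTotalDegree] at hu
    simp only [LinearMap.mulLeft_apply] at hv ⊢
    obtain ⟨w, hw⟩ := hkq.mul_dvd (Dvd.intro u rfl) (Dvd.intro v hv)
    have huw : u = q * w := mul_left_cancel₀ hk (by rw [hw, mul_assoc])
    refine ⟨w, ?_, by rw [LinearMap.mulLeft_apply, hw]⟩
    rw [SetLike.mem_coe, mem_restrictTotalDegree]
    rcases eq_or_ne w 0 with rfl | hw0
    · simp
    · rw [huw, totalDegree_mul_of_isDomain hq hw0] at hu
      omega
  have hsup : A ⊔ B ≤ restrictTotalDegree (Fin 2) ℝ (a + b + M) ⊓ I := by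
    refine le_inf (sup_le ?_ ?_) (sup_le ?_ ?_)
    · exact (map_mulLeft_restrictTotalDegree_le k _).trans_eq (by rw [← ha, add_assoc])
    · exact (map_mulLeft_restrictTotalDegree_le q _).trans_eq (by rw [← hb]; congr 1; ring)
    · rintro _ ⟨u, -, rfl⟩
      exact hkI u
    · rintro _ ⟨u, -, rfl⟩
      exact hqI u
  have h1 := Submodule.finrank_sup_add_finrank_inf_eq A B
  have h2 := Submodule.finrank_mono hAB
  have : Module.Finite ℝ ↥(restrictTotalDegree (Fin 2) ℝ (a + b + M) ⊓ I) :=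
    Submodule.finiteDimensional_of_le inf_le_left
  have h3 := Submodule.finrank_mono hsup
  rw [finrank_map_mulLeft (mul_ne_zero hk hq)] at h2
  rw [hA, finrank_map_mulLeft hk, ← hA, hB, finrank_map_mulLeft hq, ← hB] at h1
  -- The mixed second difference of `(x + 1)(x + 2) / 2` with steps `a` and `b` is `a * b`.
  have d0 := finrank_restrictTotalDegree_fin_two ℝ M
  have da := finrank_restrictTotalDegree_fin_two ℝ (a + M)
  have db := finrank_restrictTotalDegree_fin_two ℝ (b + M)
  have dab := finrank_restrictTotalDegree_fin_two ℝ (a + b + M)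
  nlinarith

/-! ### Polynomials with prescribed contact along finitely many arcs -/

theorem evalAt_add (p : ℝ × ℝ) (f g : MvPolynomial (Fin 2) ℝ) :
    evalAt p (f + g) = evalAt p f + evalAt p g := map_add _ _ _

theorem evalAt_mul (p : ℝ × ℝ) (f g : MvPolynomial (Fin 2) ℝ) :
    evalAt p (f * g) = evalAt p f * evalAt p g := map_mul _ _ _

theorem evalAt_pow (p : ℝ × ℝ) (f : MvPolynomial (Fin 2) ℝ) (n : ℕ) :
    evalAt p (f ^ n) = evalAt p f ^ n := map_pow _ _ _

theorem evalAt_prod {ι : Type*} (p : ℝ × ℝ) (s : Finset ι) (f : ι → MvPolynomial (Fin 2) ℝ) :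
    evalAt p (∏ i ∈ s, f i) = ∏ i ∈ s, evalAt p (f i) := map_prod _ _ _

theorem evalAt_X_sub_C (p : ℝ × ℝ) (c : Fin 2 → ℝ) (j : Fin 2) :
    evalAt p (X j - C (c j)) = ![p.1, p.2] j - c j := by simp [evalAt]

theorem continuous_evalAt (f : MvPolynomial (Fin 2) ℝ) : Continuous fun p => evalAt p f := by
  unfold evalAt
  refine (MvPolynomial.continuous_eval f).comp (continuous_pi fun i => ?_)
  fin_cases i
  · exact continuous_fst
  · exact continuous_snd

/-- The polynomials vanishing to order at least `n i` along the arc `γ i` at the parameter `t i`,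
for all `i`. -/
def contactSubmodule {ι : Type*} (γ : ι → ℝ → ℝ × ℝ) (t : ι → ℝ) (n : ι → ℕ) :
    Submodule ℝ (MvPolynomial (Fin 2) ℝ) where
  carrier := {P | ∀ i, (fun x => evalAt (γ i x) P) =O[𝓝 (t i)] fun x => (x - t i) ^ n i}
  add_mem' hf hg i := by simpa only [evalAt_add] using (hf i).add (hg i)
  zero_mem' i := by simpa [evalAt] using isBigO_zero _ _
  smul_mem' c f hf i := by simpa [evalAt, smul_eval] using (hf i).const_mul_left c

section Contact

variable {ι : Type*} {γ : ι → ℝ → ℝ × ℝ} {t : ι → ℝ}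

theorem contactSubmodule_antitone : Antitone (contactSubmodule γ t) := by
  intro n n' hn P hP i
  refine (hP i).trans (IsBigO.of_bound 1 ?_)
  have : ∀ᶠ x in 𝓝 (t i), |x - t i| < 1 := by
    have := Metric.ball_mem_nhds (t i) one_pos
    filter_upwards [this] with x hx
    simpa [Real.dist_eq] using hx
  filter_upwards [this] with x hx
  rw [one_mul, norm_pow, norm_pow]
  exact pow_le_pow_of_le_one (norm_nonneg _) hx.le (hn i)

theorem isBigO_one_of_continuousAt {i : ι} (hγ : ContinuousAt (γ i) (t i))
    (u : MvPolynomial (Fin 2) ℝ) :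
    (fun x => evalAt (γ i x) u) =O[𝓝 (t i)] fun _ => (1 : ℝ) :=
  ((continuous_evalAt u).continuousAt.comp hγ).isBigO_one ℝ

/-- Makes the contact space an ideal, as the codimension bound requires. -/
theorem mul_mem_contactSubmodule (hγ : ∀ i, ContinuousAt (γ i) (t i)) {n : ι → ℕ}
    {P : MvPolynomial (Fin 2) ℝ} (hP : P ∈ contactSubmodule γ t n) (u : MvPolynomial (Fin 2) ℝ) :
    P * u ∈ contactSubmodule γ t n := fun i => by
  simpa only [evalAt_mul, mul_one] using (hP i).mul (isBigO_one_of_continuousAt (hγ i) u)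

/-- A polynomial separating consecutive contact conditions. -/
theorem exists_mem_contactSubmodule_notMem [Fintype ι] [DecidableEq ι] {v : ι → ℝ × ℝ}
    (hγ : ∀ i, HasDerivAt (γ i) (v i) (t i)) (hv : ∀ i, v i ≠ 0)
    (hinj : Function.Injective fun i => γ i (t i)) (n : ι → ℕ) (i : ι) :
    ∃ P ∈ contactSubmodule γ t n, P.totalDegree ≤ ∑ j, n j ∧
      P ∉ contactSubmodule γ t (n + Pi.single i 1) := by
  set c : ι → Fin 2 → ℝ := fun j => ![(γ j (t j)).1, (γ j (t j)).2] with hc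
  have hdiff : ∀ j k, HasDerivAt (fun x => evalAt (γ j x) (X k - C (c j k)))
      (![(v j).1, (v j).2] k) (t j) := by
    intro j k
    simp only [evalAt_X_sub_C]
    fin_cases k
    · simpa using (hγ j).hasFDerivAt.fst.hasDerivAt.sub_const (c j 0)
    · simpa using (hγ j).hasFDerivAt.snd.hasDerivAt.sub_const (c j 1)
  have hzero : ∀ j k, evalAt (γ j (t j)) (X k - C (c j k)) = 0 := by
    intro j k
    rw [evalAt_X_sub_C]
    simp [hc]
  -- Choose a horizontal or vertical line through each base point: transversal to the arc when `j =
  -- i`, and missing the base point of arc `i` otherwise. The product of their powers then has order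
  -- exactly `n i` along arc `i`.
  have hsep : ∀ j, ∃ k, if j = i then ![(v i).1, (v i).2] k ≠ 0 else
      evalAt (γ i (t i)) (X k - C (c j k)) ≠ 0 := by
    intro j
    split_ifs with hj
    · by_contra! h
      exact hv i (Prod.ext (h 0) (h 1))
    · by_contra! h
      refine hj (hinj (Prod.ext ?_ ?_)).symm
      · have := h 0
        rw [evalAt_X_sub_C] at this
        simpa [hc, sub_eq_zero] using this
      · have := h 1
        rw [evalAt_X_sub_C] at this
        simpa [hc, sub_eq_zero] using this
  choose κ hκ using hsep
  set l : ι → MvPolynomial (Fin 2) ℝ := fun j => X (κ j) - C (c j (κ j)) with hl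
  refine ⟨∏ j, l j ^ n j, ?_, ?_, ?_⟩
  · intro j
    rw [← Finset.mul_prod_erase _ _ (Finset.mem_univ j)]
    have hO : (fun x => evalAt (γ j x) (l j)) =O[𝓝 (t j)] fun x => x - t j := by
      have := (hdiff j (κ j)).isBigO_sub
      simpa only [hzero, sub_zero] using this
    simpa only [evalAt_mul, evalAt_pow, mul_one] using (hO.pow (n j)).mul
      (isBigO_one_of_continuousAt (hγ j).continuousAt _)
  · refine (totalDegree_finsetProd _ _).trans (Finset.sum_le_sum fun j _ => ?_)
    refine (totalDegree_pow _ _).trans ?_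
    have : (l j).totalDegree ≤ 1 := by
      refine (totalDegree_sub_C_le _ _).trans ?_
      simp
    nlinarith
  · intro hP
    have hPi := hP i
    have hlin : (fun x => x - t i) =O[𝓝 (t i)] fun x => evalAt (γ i x) (l i) := by
      have h := hκ i
      rw [if_pos rfl] at h
      have := (HasDerivAtFilter.isTheta_sub (hdiff i (κ i)) h).2.comp_tendsto
        (tendsto_id.prodMk tendsto_const_pure)
      simpa only [Function.comp_def, id, hzero, sub_zero] using this
    have hrest : (fun _ => (1 : ℝ)) =O[𝓝 (t i)]
        fun x => evalAt (γ i x) (∏ j ∈ Finset.univ.erase i, l j ^ n j) := by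
      have hne : evalAt (γ i (t i)) (∏ j ∈ Finset.univ.erase i, l j ^ n j) ≠ 0 := by
        rw [evalAt_prod, Finset.prod_ne_zero_iff]
        intro j hj
        rw [evalAt_pow]
        have h := hκ j
        rw [if_neg (Finset.ne_of_mem_erase hj)] at h
        exact pow_ne_zero _ h
      have ht : Tendsto (fun x => evalAt (γ i x) (∏ j ∈ Finset.univ.erase i, l j ^ n j)) (𝓝 (t i))
          (𝓝 (evalAt (γ i (t i)) (∏ j ∈ Finset.univ.erase i, l j ^ n j))) :=
        ((continuous_evalAt _).continuousAt.comp (hγ i).continuousAt)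
      exact (isBigO_const_left_iff_pos_le_norm one_ne_zero).2
        ⟨_, half_pos (norm_pos_iff.2 hne), (ht.norm.eventually_const_lt
          (half_lt_self (norm_pos_iff.2 hne))).mono fun x hx => hx.le⟩
    have hlow : (fun x => (x - t i) ^ n i) =O[𝓝 (t i)]
        fun x => (x - t i) ^ (n i + 1) := by
      rw [← Finset.mul_prod_erase _ _ (Finset.mem_univ i)] at hPi
      simp only [evalAt_mul, evalAt_pow, Pi.add_apply, Pi.single_eq_same] at hPi
      refine IsBigO.trans ?_ hPi
      simpa only [mul_one] using (hlin.pow (n i)).mul hrest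
    obtain ⟨C, hC⟩ := (hlow.mono (nhdsWithin_le_nhds (s := {t i}ᶜ))).bound
    have hsmall : ∀ᶠ x in 𝓝[≠] (t i), C * |x - t i| < 1 := by
      have : ContinuousAt (fun x => C * |x - t i|) (t i) := by fun_prop
      refine nhdsWithin_le_nhds (this.eventually_lt continuousAt_const ?_)
      simp
    have hself : ∀ᶠ x in 𝓝[≠] (t i), x ≠ t i := self_mem_nhdsWithin
    obtain ⟨x, h1, h2, h3⟩ := (hC.and (hsmall.and hself)).exists
    have hpos : 0 < |x - t i| ^ n i := pow_pos (abs_pos.2 (sub_ne_zero.2 h3)) _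
    rw [norm_pow, norm_pow, Real.norm_eq_abs, pow_succ] at h1
    nlinarith

/-- Contact conditions at distinct smooth points are independent. -/
theorem finrank_contactSubmodule_add_sum_le [Fintype ι] [DecidableEq ι] {v : ι → ℝ × ℝ}
    (hγ : ∀ i, HasDerivAt (γ i) (v i) (t i)) (hv : ∀ i, v i ≠ 0)
    (hinj : Function.Injective fun i => γ i (t i)) (N : ℕ) (n : ι → ℕ) (hn : ∑ j, n j ≤ N) :
    finrank ℝ ↥(restrictTotalDegree (Fin 2) ℝ N ⊓ contactSubmodule γ t n) + ∑ j, n j ≤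
      finrank ℝ (restrictTotalDegree (Fin 2) ℝ N) := by
  induction hm : ∑ j, n j generalizing n with
  | zero => exact Submodule.finrank_mono inf_le_left
  | succ m ih =>
    obtain ⟨i, -, hi⟩ : ∃ i ∈ Finset.univ, n i ≠ 0 :=
      Finset.exists_ne_zero_of_sum_ne_zero (by omega)
    obtain ⟨n', rfl⟩ : ∃ n', n = n' + Pi.single i 1 := by
      refine ⟨n - Pi.single i 1, (tsub_add_cancel_of_le fun j => ?_).symm⟩
      rcases eq_or_ne j i with rfl | hj
      · simpa using Nat.one_le_iff_ne_zero.2 hi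
      · simp [hj]
    have hsum : ∑ j, n' j = m := by
      simpa [Finset.sum_add_distrib] using hm
    have hle := ih n' (by omega) hsum
    -- Raising one order by one lowers the dimension, since `P` is lost; `P` fits in degree `N`
    -- because `∑ j, n' j ≤ N`.
    obtain ⟨P, hP, hdeg, hP'⟩ := exists_mem_contactSubmodule_notMem hγ hv hinj n' i
    have : Module.Finite ℝ ↥(restrictTotalDegree (Fin 2) ℝ N ⊓ contactSubmodule γ t n') :=
      Submodule.finiteDimensional_of_le inf_le_left
    have hlt : restrictTotalDegree (Fin 2) ℝ N ⊓ contactSubmodule γ t (n' + Pi.single i 1) <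
        restrictTotalDegree (Fin 2) ℝ N ⊓ contactSubmodule γ t n' := by
      refine lt_of_le_of_ne (inf_le_inf_left _
        (contactSubmodule_antitone (le_add_of_nonneg_right zero_le))) fun h => hP' ?_
      have : P ∈ restrictTotalDegree (Fin 2) ℝ N ⊓ contactSubmodule γ t n' :=
        ⟨(mem_restrictTotalDegree _ _ _).2 (by omega), hP⟩
      rw [← h] at this
      exact this.2
    have := Submodule.finrank_lt_finrank_of_lt hlt
    omega

/-- Bézout's inequality for contact orders along smooth arcs. -/
theorem sum_contact_le_of_isRelPrime [Fintype ι] [DecidableEq ι] {v : ι → ℝ × ℝ}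
    (hγ : ∀ i, HasDerivAt (γ i) (v i) (t i)) (hv : ∀ i, v i ≠ 0)
    (hinj : Function.Injective fun i => γ i (t i)) (n : ι → ℕ)
    {k q : MvPolynomial (Fin 2) ℝ} (hk : k ≠ 0) (hq : q ≠ 0) (hkq : IsRelPrime k q)
    (hkn : k ∈ contactSubmodule γ t n) (hqn : q ∈ contactSubmodule γ t n) :
    ∑ i, n i ≤ k.totalDegree * q.totalDegree := by
  -- Taking `M = ∑ i, n i` makes the degree large enough for the contact conditions to be
  -- independent.
  have h1 := finrank_restrictTotalDegree_le_of_isRelPrime hk hq hkq (∑ i, n i) _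
    (mul_mem_contactSubmodule (fun i => (hγ i).continuousAt) hkn)
    (mul_mem_contactSubmodule (fun i => (hγ i).continuousAt) hqn)
  have h2 := finrank_contactSubmodule_add_sum_le hγ hv hinj
    (k.totalDegree + q.totalDegree + ∑ i, n i) n (by omega)
  omega

end Contact

/-! ### Orders of vanishing -/

theorem iteratedDeriv_eq_zero_of_lt_vanishingOrder {h : ℝ → ℝ} {t : ℝ} {n : ℕ}
    (hn : (n : ℕ∞) ≤ vanishingOrder h t) {j : ℕ} (hj : j < n) : iteratedDeriv j h t = 0 := by
  by_contra hne
  have : vanishingOrder h t ≤ j := iInf₂_le j hne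
  have := hn.trans this
  rw [Nat.cast_le] at this
  omega

theorem isBigO_of_le_vanishingOrder {h : ℝ → ℝ} {t : ℝ} (hh : ContDiffAt ℝ ∞ h t) {n : ℕ}
    (hn : (n : ℕ∞) ≤ vanishingOrder h t) : h =O[𝓝 t] fun x => (x - t) ^ n := by
  obtain ⟨u, hu, hhu⟩ := (hh.of_le (m := (n : WithTop ℕ∞)) (by exact_mod_cast le_top)).contDiffOn
    le_rfl (by simp)
  obtain ⟨ε, hε, hball⟩ := Metric.mem_nhds_iff.1 hu
  have ht : t ∈ Metric.ball t ε := Metric.mem_ball_self hε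
  have hT := taylor_isLittleO (convex_ball t ε) ht (hhu.mono hball)
  rw [Metric.isOpen_ball.nhdsWithin_eq ht] at hT
  -- Only the top term of the Taylor polynomial of degree `n` can survive.
  have hP : (fun x => taylorWithinEval h n (Metric.ball t ε) t x) =O[𝓝 t]
      fun x => (x - t) ^ n := by
    have : (fun x => taylorWithinEval h n (Metric.ball t ε) t x) = fun x =>
        (((n.factorial : ℝ)⁻¹ * (x - t) ^ n) • iteratedDerivWithin n h (Metric.ball t ε) t) := by
      ext x
      rw [taylor_within_apply, Finset.sum_range_succ, Finset.sum_eq_zero, zero_add]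
      intro j hj
      rw [iteratedDerivWithin_of_isOpen Metric.isOpen_ball ht,
        iteratedDeriv_eq_zero_of_lt_vanishingOrder hn (Finset.mem_range.1 hj), smul_zero]
    rw [this]
    have := (isBigO_refl (fun x : ℝ => (x - t) ^ n) (𝓝 t)).const_mul_left
      ((n.factorial : ℝ)⁻¹ * iteratedDerivWithin n h (Metric.ball t ε) t)
    refine this.congr_left fun x => ?_
    simp only [smul_eq_mul]
    ring
  simpa using hT.isBigO.add hP

/-! ### Differentiating a smooth family of polynomials -/

theorem evalAt_sum {ι : Type*} (p : ℝ × ℝ) (s : Finset ι) (f : ι → MvPolynomial (Fin 2) ℝ) :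
    evalAt p (∑ i ∈ s, f i) = ∑ i ∈ s, evalAt p (f i) := map_sum _ _ _

theorem evalAt_monomial (p : ℝ × ℝ) (m : Fin 2 →₀ ℕ) (c : ℝ) :
    evalAt p (monomial m c) = c * evalAt p (monomial m 1) := by
  simp [evalAt, eval_monomial]

theorem hasDerivAt_evalAt {γ : ℝ → ℝ × ℝ} {v : ℝ × ℝ} {t : ℝ} (hγ : HasDerivAt γ v t)
    (P : MvPolynomial (Fin 2) ℝ) :
    HasDerivAt (fun x => evalAt (γ x) P)
      (evalAt (γ t) (pderiv 0 P) * v.1 + evalAt (γ t) (pderiv 1 P) * v.2) t := by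
  induction P using MvPolynomial.induction_on with
  | C c => simpa [evalAt] using hasDerivAt_const t c
  | add p q hp hq =>
    simp only [evalAt_add, map_add]
    refine (hp.add hq).congr_deriv ?_
    ring
  | mul_X p i hp =>
    have hX : HasDerivAt (fun x => evalAt (γ x) (X i))
        (evalAt (γ t) (pderiv 0 (X i)) * v.1 + evalAt (γ t) (pderiv 1 (X i)) * v.2) t := by
      fin_cases i
      · simpa [evalAt] using hγ.hasFDerivAt.fst.hasDerivAt
      · simpa [evalAt] using hγ.hasFDerivAt.snd.hasDerivAt
    simp only [evalAt_mul, Derivation.leibniz, smul_eq_mul, evalAt_add]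
    refine (hp.mul hX).congr_deriv ?_
    ring

/-- The derivative of a family of plane polynomials of degree at most `d` with respect to its
parameter. -/
noncomputable def polyFamilyDeriv (f : ℝ → MvPolynomial (Fin 2) ℝ) (d : ℕ) (s : ℝ) :
    MvPolynomial (Fin 2) ℝ :=
  ∑ m ∈ (Finsupp.finite_of_degree_le (σ := Fin 2) d).toFinset,
    monomial m (deriv (fun s => (f s).coeff m) s)

theorem totalDegree_polyFamilyDeriv_le (f : ℝ → MvPolynomial (Fin 2) ℝ) (d : ℕ) (s : ℝ) :
    (polyFamilyDeriv f d s).totalDegree ≤ d := by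
  refine totalDegree_finsetSum_le fun m hm => (totalDegree_monomial_le _ _).trans ?_
  have hm' : m.degree ≤ d := by simpa using hm
  exact hm'

theorem evalAt_eq_sum_of_totalDegree_le {P : MvPolynomial (Fin 2) ℝ} {d : ℕ}
    (hP : P.totalDegree ≤ d) (p : ℝ × ℝ) :
    evalAt p P = ∑ m ∈ (Finsupp.finite_of_degree_le (σ := Fin 2) d).toFinset,
      P.coeff m * evalAt p (monomial m 1) := by
  conv_lhs => rw [P.as_sum, evalAt_sum]
  simp only [evalAt_monomial p _ (coeff _ P)]
  refine Finset.sum_subset (fun m hm => ?_) fun m _ hm => ?_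
  · have hm' : m.degree ≤ d := (le_totalDegree hm).trans hP
    simpa using hm'
  · rw [notMem_support_iff.1 hm, zero_mul]

theorem hasDerivAt_evalAt_family {f : ℝ → MvPolynomial (Fin 2) ℝ} {d : ℕ} {s : ℝ}
    (hf : ∀ m, DifferentiableAt ℝ (fun s => (f s).coeff m) s)
    (hdeg : ∀ᶠ s' in 𝓝 s, (f s').totalDegree ≤ d) {γ : ℝ → ℝ × ℝ} {v : ℝ × ℝ}
    (hγ : HasDerivAt γ v s) :
    HasDerivAt (fun x => evalAt (γ x) (f x)) (evalAt (γ s) (polyFamilyDeriv f d s) +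
      (evalAt (γ s) (pderiv 0 (f s)) * v.1 + evalAt (γ s) (pderiv 1 (f s)) * v.2)) s := by
  have hfix := hasDerivAt_evalAt hγ (f s)
  have hs := hdeg.self_of_nhds
  have hsum := HasDerivAt.fun_sum (u := (Finsupp.finite_of_degree_le (σ := Fin 2) d).toFinset)
    fun m _ => (hf m).hasDerivAt.mul (hasDerivAt_evalAt hγ (monomial m 1))
  have hfix' := HasDerivAt.fun_sum (u := (Finsupp.finite_of_degree_le (σ := Fin 2) d).toFinset)
    fun m _ => (hasDerivAt_evalAt hγ (monomial m 1)).const_mul ((f s).coeff m)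
  -- Expanding the fixed polynomial `f s` in monomials identifies the part of the product rule that
  -- leaves the coefficients alone with the gradient term.
  have hu := hfix.unique (hfix'.congr_of_eventuallyEq
    (Eventually.of_forall fun x => evalAt_eq_sum_of_totalDegree_le hs (γ x)))
  refine (hsum.congr_of_eventuallyEq
    (hdeg.mono fun x hx => evalAt_eq_sum_of_totalDegree_le hx (γ x))).congr_deriv ?_
  rw [hu, Finset.sum_add_distrib, polyFamilyDeriv, evalAt_sum]
  simp only [evalAt_monomial _ _ (deriv _ s)]

/-! ### The Jacobian along a curve of the family -/

theorem ContinuousLinearMap.det_prod_eq (A : ℝ × ℝ →L[ℝ] ℝ × ℝ) :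
    A.det = (A (1, 0)).1 * (A (0, 1)).2 - (A (1, 0)).2 * (A (0, 1)).1 := by
  rw [ContinuousLinearMap.det, ← LinearMap.det_toMatrix (Basis.finTwoProd ℝ), Matrix.det_fin_two]
  simp [LinearMap.toMatrix_apply]
  ring

section Family

variable {U : Set (ℝ × ℝ)} {F : ℝ × ℝ → ℝ × ℝ} {s t : ℝ}

theorem contDiffAt_fderiv_apply (hU : IsOpen U) (hF : ContDiffOn ℝ ∞ F U) (hst : (s, t) ∈ U)
    (w : ℝ × ℝ) : ContDiffAt ℝ ∞ (fun x => fderiv ℝ F (s, x) w) t := by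
  have h1 : ContDiffAt ℝ ∞ (fderiv ℝ F) (s, t) :=
    (hF.contDiffAt (hU.mem_nhds hst)).fderiv_right (by norm_cast)
  have h2 : ContDiffAt ℝ ∞ (fun x : ℝ => (s, x)) t := contDiffAt_const.prodMk contDiffAt_id
  exact (ContDiffAt.comp t h1 h2).clm_apply contDiffAt_const

theorem contDiffAt_jacobian (hU : IsOpen U) (hF : ContDiffOn ℝ ∞ F U) (hst : (s, t) ∈ U) :
    ContDiffAt ℝ ∞ (jacobian F s) t := by
  have h1 := contDiffAt_fderiv_apply hU hF hst (1, 0)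
  have h2 := contDiffAt_fderiv_apply hU hF hst (0, 1)
  have : jacobian F s = fun x => (fderiv ℝ F (s, x) (1, 0)).1 * (fderiv ℝ F (s, x) (0, 1)).2 -
      (fderiv ℝ F (s, x) (1, 0)).2 * (fderiv ℝ F (s, x) (0, 1)).1 := by
    ext x
    exact ContinuousLinearMap.det_prod_eq _
  rw [this]
  exact (h1.fst.mul h2.snd).sub (h1.snd.mul h2.fst)

theorem hasDerivAt_family_fst (hU : IsOpen U) (hF : ContDiffOn ℝ ∞ F U) (hst : (s, t) ∈ U) :
    HasDerivAt (fun x => F (x, t)) (fderiv ℝ F (s, t) (1, 0)) s :=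
  ((hF.contDiffAt (hU.mem_nhds hst)).differentiableAt (by simp)).hasFDerivAt.comp_hasDerivAt s
    ((hasDerivAt_id s).prodMk (hasDerivAt_const s t))

theorem hasDerivAt_family_snd (hU : IsOpen U) (hF : ContDiffOn ℝ ∞ F U) (hst : (s, t) ∈ U) :
    HasDerivAt (fun x => F (s, x)) (fderiv ℝ F (s, t) (0, 1)) t :=
  ((hF.contDiffAt (hU.mem_nhds hst)).differentiableAt (by simp)).hasFDerivAt.comp_hasDerivAt t
    ((hasDerivAt_const t s).prodMk (hasDerivAt_id t))

/-- With `x', y'` the velocity of `Γ_s` and `g = ∂f_s/∂s`, Cramer's rule gives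
`∂f/∂x · J = -g y'` and `∂f/∂y · J = g x'` along `Γ_s`. -/
theorem jacobian_relations (hU : IsOpen U) (hF : ContDiffOn ℝ ∞ F U) {d : ℕ} {V : Set ℝ}
    (hV : IsOpen V) (hsV : s ∈ V) {f : ℝ → MvPolynomial (Fin 2) ℝ}
    (hf : ∀ m, ContDiffOn ℝ ∞ (fun s => (f s).coeff m) V)
    (hdeg : ∀ s ∈ V, (f s).totalDegree = d)
    (hzero : ∀ s ∈ V, ∀ p ∈ familyCurve U F s, evalAt p (f s) = 0) (hst : (s, t) ∈ U) :
    evalAt (F (s, t)) (pderiv 0 (f s)) * jacobian F s t =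
        -(evalAt (F (s, t)) (polyFamilyDeriv f d s) * (fderiv ℝ F (s, t) (0, 1)).2) ∧
      evalAt (F (s, t)) (pderiv 1 (f s)) * jacobian F s t =
        evalAt (F (s, t)) (polyFamilyDeriv f d s) * (fderiv ℝ F (s, t) (0, 1)).1 := by
  have hVs := hV.mem_nhds hsV
  have h1 : evalAt (F (s, t)) (pderiv 0 (f s)) * (fderiv ℝ F (s, t) (0, 1)).1 +
      evalAt (F (s, t)) (pderiv 1 (f s)) * (fderiv ℝ F (s, t) (0, 1)).2 = 0 := by
    refine (hasDerivAt_evalAt (hasDerivAt_family_snd hU hF hst) (f s)).unique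
      ((hasDerivAt_const t (0 : ℝ)).congr_of_eventuallyEq ?_)
    have : ∀ᶠ x in 𝓝 t, (s, x) ∈ U :=
      (Continuous.prodMk_right s).continuousAt.eventually (hU.mem_nhds hst)
    exact this.mono fun x hx => hzero s hsV _ ⟨x, hx, rfl⟩
  have h2 := (hasDerivAt_evalAt_family (d := d)
    (fun m => ((hf m).contDiffAt hVs).differentiableAt (by simp))
    (by filter_upwards [hVs] with x hx using (hdeg x hx).le)
    (hasDerivAt_family_fst hU hF hst)).unique
      ((hasDerivAt_const s (0 : ℝ)).congr_of_eventuallyEq (by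
        have : ∀ᶠ x in 𝓝 s, (x, t) ∈ U :=
          (Continuous.prodMk_left t).continuousAt.eventually (hU.mem_nhds hst)
        filter_upwards [this, hVs] with x hx hxV using hzero x hxV _ ⟨t, hx, rfl⟩))
  rw [jacobian, ContinuousLinearMap.det_prod_eq]
  constructor
  · linear_combination (-(fderiv ℝ F (s, t) (1, 0)).2) * h1 + (fderiv ℝ F (s, t) (0, 1)).2 * h2
  · linear_combination (fderiv ℝ F (s, t) (1, 0)).1 * h1 - (fderiv ℝ F (s, t) (0, 1)).1 * h2

end Family

/-! ### ### The bound on the index -/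

/-- To bound a finite sum in `ℕ∞` it suffices to bound the sums of natural minorants. -/
theorem ENat.sum_le_of_forall_natCast_le {ι : Type*} (T : Finset ι) (M : ι → ℕ∞) (D : ℕ)
    (h : ∀ n : ι → ℕ, (∀ i ∈ T, (n i : ℕ∞) ≤ M i) → ∑ i ∈ T, n i ≤ D) : ∑ i ∈ T, M i ≤ D := by
  -- Truncating at `D + 1` makes the terms finite; a term that was really cut would alone exceed
  -- `D`.
  have hcast : ∀ i, ((min (M i) (D + 1 : ℕ)).toNat : ℕ∞) = min (M i) (D + 1 : ℕ) := fun i =>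
    ENat.natCast_toNat (ne_top_of_le_ne_top (ENat.natCast_ne_top _) (min_le_right _ _))
  have hn := h (fun i => (min (M i) (D + 1 : ℕ)).toNat) fun i _ => by
    rw [hcast]
    exact min_le_left _ _
  have hM : ∀ i ∈ T, M i = ((min (M i) (D + 1 : ℕ)).toNat : ℕ∞) := by
    intro i hi
    rw [hcast, eq_comm, min_eq_left_iff]
    by_contra! hlt
    have h1 := (Finset.single_le_sum (f := fun i => (min (M i) (D + 1 : ℕ)).toNat)
      (fun _ _ => Nat.zero_le _) hi).trans hn
    simp only [min_eq_right hlt.le, ENat.toNat_natCast] at h1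
    omega
  rw [Finset.sum_congr rfl hM]
  exact_mod_cast hn

theorem theorem5 (U : Set (ℝ × ℝ)) (hU : IsOpen U) (F : ℝ × ℝ → ℝ × ℝ)
    (hF : ContDiffOn ℝ ∞ F U)
    (hreg : ∀ s t : ℝ, (s, t) ∈ U → fderiv ℝ F (s, t) (0, 1) ≠ 0)
    (d : ℕ) (hd : IsAlgebraicFamily U F d)
    (s : ℝ)
    (hs : ∀ a b : ℝ, a < b → (∀ t ∈ Set.Ioo a b, (s, t) ∈ U) →
      ∃ t ∈ Set.Ioo a b, jacobian F s t ≠ 0) :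
    infIntersectionIndex U F s ≤ (d : ℕ∞) ^ 2 := by
  rcases (familyCurve U F s).eq_empty_or_nonempty with hempty | hne
  · have : IsEmpty (familyCurve U F s) := Set.isEmpty_coe_sort.2 hempty
    refine iSup_le fun T => ?_
    rw [T.eq_empty_of_isEmpty]
    simp
  obtain ⟨f, V, hV, hsV, hf, hfV⟩ := hd s hne
  have hzero : ∀ s ∈ V, ∀ p ∈ familyCurve U F s, evalAt p (f s) = 0 :=
    fun s hs p hp => ((hfV s hs).2 p hp).1
  have hsing : ∀ p ∈ familyCurve U F s, ¬ (evalAt p (pderiv 0 (f s)) = 0 ∧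
      evalAt p (pderiv 1 (f s)) = 0) := fun p hp => ((hfV s hsV).2 p hp).2
  have hrel : ∀ t, (s, t) ∈ U → _ := fun t ht =>
    jacobian_relations hU hF hV hsV hf (fun s hs => (hfV s hs).1) hzero ht
  set g := polyFamilyDeriv f d s with hg
  have hgdeg : g.totalDegree ≤ d := totalDegree_polyFamilyDeriv_le f d s
  have hnear : ∀ t, (s, t) ∈ U → ∀ᶠ x in 𝓝 t, (s, x) ∈ U := fun t ht =>
    (Continuous.prodMk_right s).continuousAt.eventually (hU.mem_nhds ht)
  -- If `g` vanished on an arc, then `J · ∇f_s = 0` there, and a point with `J ≠ 0` would be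
  -- singular.
  have hg_near : ∀ t, (s, t) ∈ U → ∃ᶠ x in 𝓝 t, evalAt (F (s, x)) g ≠ 0 := by
    intro t ht hev
    obtain ⟨a, b, hab, hIoo⟩ := mem_nhds_iff_exists_Ioo_subset.1 (hev.and (hnear t ht))
    obtain ⟨x, hx, hxj⟩ := hs a b (hab.1.trans hab.2) fun x hx => (hIoo hx).2
    obtain ⟨hg0, hxU⟩ := hIoo hx
    obtain ⟨r1, r2⟩ := hrel x hxU
    rw [not_not.1 hg0, zero_mul] at r1 r2
    rw [neg_zero] at r1
    exact hsing _ ⟨x, hxU, rfl⟩ ⟨(mul_eq_zero.1 r1).resolve_right hxj,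
      (mul_eq_zero.1 r2).resolve_right hxj⟩
  have hf0 : f s ≠ 0 := by
    rintro h0
    obtain ⟨p, hp⟩ := hne
    exact hsing p hp (by simp [h0, evalAt])
  obtain ⟨k, q, h, hkq, hk, hq⟩ := UniqueFactorizationMonoid.exists_reduced_factors (f s) hf0 g
  have hk0 : k ≠ 0 := by rintro rfl; exact hf0 (by rw [← hk, mul_zero])
  have hh0 : h ≠ 0 := by rintro rfl; exact hf0 (by rw [← hk, zero_mul])
  have hg0 : g ≠ 0 := by
    intro h0
    obtain ⟨_, t, ht, rfl⟩ := hne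
    obtain ⟨x, hx⟩ := (hg_near t ht).exists
    exact hx (by simp [h0, evalAt])
  have hq0 : q ≠ 0 := by rintro rfl; exact hg0 (by rw [← hq, mul_zero])
  have hcont : ∀ t, (s, t) ∈ U → ∀ P, ContinuousAt (fun x => evalAt (F (s, x)) P) t :=
    fun t ht P => ((continuous_evalAt P).continuousAt.comp
      (hasDerivAt_family_snd hU hF ht).continuousAt)
  have hfhk : ∀ t, (s, t) ∈ U → evalAt (F (s, t)) h * evalAt (F (s, t)) k = 0 := by
    intro t ht
    rw [← evalAt_mul, hk]
    exact hzero s hsV _ ⟨t, ht, rfl⟩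
  have hh_ne : ∀ t, (s, t) ∈ U → evalAt (F (s, t)) h ≠ 0 := by
    intro t ht hht
    have hkt : evalAt (F (s, t)) k ≠ 0 := by
      intro hkt
      refine hsing _ ⟨t, ht, rfl⟩ ?_
      simp [← hk, evalAt_add, evalAt_mul, hht, hkt]
    refine hg_near t ht ?_
    filter_upwards [(hcont t ht k).eventually_ne hkt, hnear t ht] with x hx hxU
    rw [not_not, ← hq, evalAt_mul, (mul_eq_zero.1 (hfhk x hxU)).resolve_right hx, zero_mul]
  have hkzero : ∀ t, (s, t) ∈ U → evalAt (F (s, t)) k = 0 := fun t ht =>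
    (mul_eq_zero.1 (hfhk t ht)).resolve_left (hh_ne t ht)
  have hq_isBigO : ∀ t, (s, t) ∈ U →
      (fun x => evalAt (F (s, x)) q) =O[𝓝 t] jacobian F s := by
    intro t ht
    -- Pairing the relation `J · ∇f_s = h q · (-y', x')` with `(-y', x')` and dividing by `(x'² +
    -- y'²) h` gives `q = μ J` with `μ` continuous.
    set μ : ℝ → ℝ := fun x =>
      (evalAt (F (s, x)) (pderiv 1 (f s)) * (fderiv ℝ F (s, x) (0, 1)).1 -
        evalAt (F (s, x)) (pderiv 0 (f s)) * (fderiv ℝ F (s, x) (0, 1)).2) /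
      (((fderiv ℝ F (s, x) (0, 1)).1 ^ 2 + (fderiv ℝ F (s, x) (0, 1)).2 ^ 2) *
        evalAt (F (s, x)) h) with hμ
    have hpos : ∀ x, (s, x) ∈ U →
        (fderiv ℝ F (s, x) (0, 1)).1 ^ 2 + (fderiv ℝ F (s, x) (0, 1)).2 ^ 2 ≠ 0 := by
      intro x hx h0
      have h1 := sq_nonneg (fderiv ℝ F (s, x) (0, 1)).1
      have h2 := sq_nonneg (fderiv ℝ F (s, x) (0, 1)).2
      refine hreg s x hx (Prod.ext ?_ ?_)
      · exact (pow_eq_zero_iff two_ne_zero).1 (le_antisymm (by linarith) h1)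
      · exact (pow_eq_zero_iff two_ne_zero).1 (le_antisymm (by linarith) h2)
    have hv : ContinuousAt (fun x => fderiv ℝ F (s, x) (0, 1)) t :=
      (contDiffAt_fderiv_apply hU hF ht (0, 1)).continuousAt
    have hμc : ContinuousAt μ t := by
      refine ContinuousAt.div (((hcont t ht _).mul hv.fst).sub ((hcont t ht _).mul hv.snd))
        (((hv.fst.pow 2).add (hv.snd.pow 2)).mul (hcont t ht h))
        (mul_ne_zero (hpos t ht) (hh_ne t ht))
    have hEq : (fun x => μ x * jacobian F s x) =ᶠ[𝓝 t] fun x => evalAt (F (s, x)) q := by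
      filter_upwards [hnear t ht] with x hx
      obtain ⟨r1, r2⟩ := hrel x hx
      rw [← hq, evalAt_mul] at r1 r2
      rw [hμ]
      simp only
      rw [div_mul_eq_mul_div, div_eq_iff (mul_ne_zero (hpos x hx) (hh_ne x hx))]
      linear_combination (fderiv ℝ F (s, x) (0, 1)).1 * r2 - (fderiv ℝ F (s, x) (0, 1)).2 * r1
    refine IsBigO.congr' ?_ hEq EventuallyEq.rfl
    simpa only [one_mul] using (hμc.isBigO_one ℝ).mul (isBigO_refl (jacobian F s) (𝓝 t))
  refine iSup_le fun T => ?_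
  have hbound := ENat.sum_le_of_forall_natCast_le T
    (fun p => infIntersectionMultiplicity U F s p) (d ^ 2) ?_
  · simpa using hbound
  intro n hn
  -- One parameter value per point suffices: `n p` is finite, so if positive, `n p - 1` lies
  -- strictly below the supremum and some branch already has order at least `n p`.
  have hparam : ∀ p : T, ∃ t, ((s, t) ∈ U ∧ F (s, t) = p.1) ∧
      (n p : ℕ∞) ≤ vanishingOrder (jacobian F s) t := by
    rintro ⟨⟨p, t, ht, htp⟩, hpT⟩
    rcases Nat.eq_zero_or_pos (n ⟨p, t, ht, htp⟩) with h0 | hpos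
    · exact ⟨t, ⟨ht, htp⟩, by simp [h0]⟩
    · have hlt : ((n ⟨p, t, ht, htp⟩ - 1 : ℕ) : ℕ∞) < infIntersectionMultiplicity U F s p :=
        lt_of_lt_of_le (by exact_mod_cast Nat.sub_lt hpos one_pos) (hn _ hpT)
      obtain ⟨t', hlt'⟩ := lt_iSup_iff.1 hlt
      obtain ⟨ht', hlt'⟩ := lt_iSup_iff.1 hlt'
      refine ⟨t', ht', ?_⟩
      have := Order.add_one_le_of_lt hlt'
      have hc : (n ⟨p, t, ht, htp⟩ : ℕ∞) = ((n ⟨p, t, ht, htp⟩ - 1 : ℕ) : ℕ∞) + 1 := by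
        exact_mod_cast (Nat.sub_add_cancel hpos).symm
      rw [hc]
      exact this
  choose τ hτ hτn using hparam
  classical
  have hmain := sum_contact_le_of_isRelPrime (γ := fun (_ : T) x => F (s, x)) (t := τ)
    (fun p => hasDerivAt_family_snd hU hF (hτ p).1) (fun p => hreg s _ (hτ p).1)
    (fun p p' hpp => by
      simp only [(hτ _).2] at hpp
      exact Subtype.ext (Subtype.ext hpp))
    (fun p => n p) hk0 hq0 hkq
    (fun p => (isBigO_zero _ _).congr' (by
      filter_upwards [hnear _ (hτ p).1] with x hx using (hkzero x hx).symm) EventuallyEq.rfl)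
    (fun p => (hq_isBigO _ (hτ p).1).trans
      (isBigO_of_le_vanishingOrder (contDiffAt_jacobian hU hF (hτ p).1) (hτn p)))
  rw [Finset.sum_coe_sort T n] at hmain
  have hkd : k.totalDegree ≤ d := by
    rw [← (hfV s hsV).1, ← hk, totalDegree_mul_of_isDomain hh0 hk0]
    omega
  have hqd : q.totalDegree ≤ d := by
    refine le_trans ?_ hgdeg
    rw [← hq, totalDegree_mul_of_isDomain hh0 hq0]
    omega
  calc ∑ p ∈ T, n p ≤ k.totalDegree * q.totalDegree := hmain
    _ ≤ d * d := Nat.mul_le_mul hkd hqd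
    _ = d ^ 2 := (sq d).symm
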